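/- Let $k$ be an algebraically closed field and let $S$ be a local Noetherian normal commutative $k$-domain with maximal ideal $\mathfrak m$ such that $S/\mathfrak m = k$. Let $G$ be a finite subgroup of the group $\mathrm{Aut}_k(S)$ of $k$-algebra automorphisms of $S$ such that $|G|$ is invertible in $k$, and let $R = S^G$ be the invariant ring. Assume that $R \hookrightarrow S$ is unramified in codimension one: it is essentially of finite type and, for every prime $\mathfrak p$ of height one in $S$ with $\mathfrak q = \mathfrak p \cap R$, one has $\mathfrak q S_{\mathfrak p} = \mathfrak p S_{\mathfrak p}$ and the residue field extension $\kappa(\mathfrak q) \subseteq \kappa(\mathfrak p)$ is separable. Let $S*G = \bigoplus_{g \in G} S g$ be the skew group ring, with multiplication $(sg)(th) = s\,g(t)\cdot gh$. Let $\mathrm{Ref}(R)$ be the category of finitely generated reflexive $R$-modules with $R$-linear maps, and let $\mathrm{Ref}(S*G)$ be the category of finitely generated left $S*G$-modules that are reflexive as $S$-modules, with $S*G$-linear maps. Write $(-)^* = \mathrm{Hom}_S(-,S)$, where for an $S*G$-module $M$ the group $G$ acts on $M^*$ by $g(\varphi) = g \circ \varphi \circ g^{-1}$, and let $G$ act on $S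 \otimes_R N$ by $g(s \otimes n) = g(s) \otimes n$. Then $M \mapsto M^G$, $\varphi \mapsto \varphi|_{M^G}$, defines a functor $\mathcal G : \mathrm{Ref}(S*G) \to \mathrm{Ref}(R)$, and $N \mapsto (S \otimes_R N)^{**}$, $\psi \mapsto (\mathrm{id}_S \otimes \psi)^{**}$, defines a functor $\mathcal G' : \mathrm{Ref}(R) \to \mathrm{Ref}(S*G)$, and these two functors are mutually quasi-inverse; they give an equivalence of categories $\mathrm{Ref}(S*G) \cong \mathrm{Ref}(R)$. -/

import Mathlib

open CategoryTheory

universe u v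

noncomputable section

namespace AuslanderRef

section Unramified

/-- A local homomorphism `(A, 𝔪, K) → (B, 𝔫, L)` of local rings is unramified if `𝔪B = 𝔫` and
`L/K` is a separable field extension. (The finiteness condition that goes with this notion is
part of `UnramifiedInCodimOne`.) -/
def IsUnramifiedLocalHom {A B : Type*} [CommRing A] [IsLocalRing A] [CommRing B] [IsLocalRing B]
    (f : A →+* B) [IsLocalHom f] : Prop :=
  (IsLocalRing.maximalIdeal A).map f = IsLocalRing.maximalIdeal B ∧
    @Algebra.IsSeparable (IsLocalRing.ResidueField A) (IsLocalRing.ResidueField B) _ _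
      (IsLocalRing.ResidueField.map f).toAlgebra

/-- `A → B` is essentially of finite type, and `A_{𝔭 ∩ A} → B_𝔭` is unramified for every prime
`𝔭` of height one in `B`. -/
def UnramifiedInCodimOne (A B : Type*) [CommRing A] [CommRing B] [Algebra A B] : Prop :=
  Algebra.EssFiniteType A B ∧
    ∀ (p : Ideal B) [p.IsPrime], p.height = 1 →
      IsUnramifiedLocalHom (Localization.localRingHom (p.comap (algebraMap A B)) p
        (algebraMap A B) rfl)

end Unramified

section Skew

variable (S : Type u) [CommRing S] (G : Type u) [Group G] [MulSemiringAction G S]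

/-- The embedding `S → S * G`, `s ↦ s · 1_G`. The skew group ring `S * G`, with multiplication
`(s g) (t h) = s g(t) · gh`, is `SkewMonoidAlgebra S G`; the element `s g` is `single g s`. -/
def inclSkew : S →+* SkewMonoidAlgebra S G where
  toFun s := SkewMonoidAlgebra.single 1 s
  map_one' := rfl
  map_mul' s t := by simp [SkewMonoidAlgebra.single_mul_single]
  map_zero' := by simp
  map_add' s t := by simp [SkewMonoidAlgebra.single_add]

variable {S G}

/-- An `S * G`-module is an `S`-module through `inclSkew`. -/
instance instModuleBase (M : ModuleCat.{u} (SkewMonoidAlgebra S G)) : Module S M :=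
  Module.compHom M (inclSkew S G)

theorem smul_def (M : ModuleCat.{u} (SkewMonoidAlgebra S G)) (s : S) (m : M) :
    s • m = SkewMonoidAlgebra.single (1 : G) s • m := rfl

/-- The `S`-linear map underlying a homomorphism of `S * G`-modules. -/
def homBase {M N : ModuleCat.{u} (SkewMonoidAlgebra S G)} (f : M ⟶ N) : M →ₗ[S] N where
  toFun := f.hom
  map_add' := f.hom.map_add
  map_smul' s m := f.hom.map_smul (SkewMonoidAlgebra.single (1 : G) s) m

/-- The action of `G` on an `S * G`-module `M`. -/
def act (M : ModuleCat.{u} (SkewMonoidAlgebra S G)) : G →* AddMonoid.End M where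
  toFun g := DistribSMul.toAddMonoidHom M (SkewMonoidAlgebra.single g (1 : S))
  map_one' := by
    ext m
    exact one_smul (SkewMonoidAlgebra S G) m
  map_mul' g h := by
    ext m
    change SkewMonoidAlgebra.single (g * h) (1 : S) • m =
      SkewMonoidAlgebra.single g (1 : S) • SkewMonoidAlgebra.single h (1 : S) • m
    rw [← mul_smul]
    simp [SkewMonoidAlgebra.single_mul_single]

theorem act_apply (M : ModuleCat.{u} (SkewMonoidAlgebra S G)) (g : G) (m : M) :
    act M g m = SkewMonoidAlgebra.single g (1 : S) • m := rfl

theorem act_smul (M : ModuleCat.{u} (SkewMonoidAlgebra S G)) (g : G) (s : S) (m : M) :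
    act M g (s • m) = (g • s) • act M g m := by
  rw [act_apply, act_apply, smul_def, smul_def, ← mul_smul, ← mul_smul]
  simp [SkewMonoidAlgebra.single_mul_single]

theorem map_act {M N : ModuleCat.{u} (SkewMonoidAlgebra S G)} (f : M ⟶ N) (g : G) (m : M) :
    homBase f (act M g m) = act N g (homBase f m) :=
  f.hom.map_smul _ _

/-- An `S`-module with a compatible action of `G`, i.e. `g(sm) = g(s)g(m)`, as an `S * G`-module:
`(s g) m = s g(m)`. -/
abbrev skewModule (M : Type u) [AddCommGroup M] [Module S M] (ρ : G →* AddMonoid.End M)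
    (h : ∀ (g : G) (s : S) (m : M), ρ g (s • m) = (g • s) • ρ g m) :
    Module (SkewMonoidAlgebra S G) M :=
  Module.compHom M (SkewMonoidAlgebra.liftNCRingHom (Module.toAddMonoidEnd S M) ρ
    (fun {s g} => by
      ext m
      exact (h g s m).symm))

/-- The `S * G`-module given by an `S`-module with a compatible action of `G`. -/
def ofAction (M : Type u) [AddCommGroup M] [Module S M] (ρ : G →* AddMonoid.End M)
    (h : ∀ (g : G) (s : S) (m : M), ρ g (s • m) = (g • s) • ρ g m) :
    ModuleCat.{u} (SkewMonoidAlgebra S G) :=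
  @ModuleCat.of (SkewMonoidAlgebra S G) _ M _ (skewModule M ρ h)

theorem single_smul_ofAction (M : Type u) [AddCommGroup M] [Module S M]
    (ρ : G →* AddMonoid.End M)
    (h : ∀ (g : G) (s : S) (m : M), ρ g (s • m) = (g • s) • ρ g m) (g : G) (s : S) (m : M) :
    letI := skewModule M ρ h
    SkewMonoidAlgebra.single g s • m = s • ρ g m := by
  change (SkewMonoidAlgebra.liftNC _ _ (SkewMonoidAlgebra.single g s) : AddMonoid.End M) m = _
  rw [SkewMonoidAlgebra.liftNC_single]
  rfl

/-- An `S`-linear map that commutes with the actions of `G` is `S * G`-linear. -/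
def ofActionHom {M N : Type u} [AddCommGroup M] [Module S M] [AddCommGroup N] [Module S N]
    {ρ : G →* AddMonoid.End M} {h : ∀ (g : G) (s : S) (m : M), ρ g (s • m) = (g • s) • ρ g m}
    {σ : G →* AddMonoid.End N} {h' : ∀ (g : G) (s : S) (n : N), σ g (s • n) = (g • s) • σ g n}
    (f : M →ₗ[S] N) (hf : ∀ g m, f (ρ g m) = σ g (f m)) :
    ofAction M ρ h ⟶ ofAction N σ h' :=
  letI := skewModule M ρ h
  letI := skewModule N σ h'
  ModuleCat.ofHom (X := M) (Y := N)
    { toFun := f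
      map_add' := f.map_add
      map_smul' := fun a m => by
        induction a using SkewMonoidAlgebra.induction_on with
        | zero => simp
        | single g s =>
          have h₁ := single_smul_ofAction M ρ h g s m
          have h₂ := single_smul_ofAction N σ h' g s (f m)
          refine (congrArg f h₁).trans (Eq.trans ?_ h₂.symm)
          rw [f.map_smul, hf]
        | add a b ha hb =>
          rw [add_smul, map_add, ha, hb]
          simp [add_smul] }

end Skew

section Dual

variable {S : Type u} [CommRing S] {G : Type u} [Group G] [MulSemiringAction G S]

/-- The action of `G` on `Hom_S(M, S)`: `g(φ) = g ∘ φ ∘ g⁻¹`. -/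
def dualAct (M : ModuleCat.{u} (SkewMonoidAlgebra S G)) :
    G →* AddMonoid.End (Module.Dual S M) where
  toFun g :=
    { toFun := fun φ =>
        { toFun := fun m => g • φ (act M g⁻¹ m)
          map_add' := fun m n => by rw [map_add, map_add, smul_add]
          map_smul' := fun s m => by
            rw [act_smul, map_smul]
            simp [smul_mul'] }
      map_zero' := by ext m; exact smul_zero g
      map_add' := fun φ ψ => by ext m; exact smul_add g _ _ }
  map_one' := by
    ext φ m
    change (1 : G) • φ (act M 1⁻¹ m) = φ m
    rw [inv_one, map_one, one_smul]
    rfl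
  map_mul' g h := by
    ext φ m
    change (g * h) • φ (act M (g * h)⁻¹ m) = g • h • φ (act M h⁻¹ (act M g⁻¹ m))
    rw [mul_inv_rev, map_mul, mul_smul]
    rfl

theorem dualAct_apply (M : ModuleCat.{u} (SkewMonoidAlgebra S G)) (g : G)
    (φ : Module.Dual S M) (m : M) :
    dualAct M g φ m = g • φ (act M g⁻¹ m) := rfl

theorem dualAct_smul (M : ModuleCat.{u} (SkewMonoidAlgebra S G)) (g : G) (s : S)
    (φ : Module.Dual S M) :
    dualAct M g (s • φ) = (g • s) • dualAct M g φ := by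
  ext m
  exact smul_mul' g s (φ (act M g⁻¹ m))

variable (S G)

/-- The contravariant functor `M ↦ M^* = Hom_S(M, S)` on `S * G`-modules. -/
def dualFunctor : (ModuleCat.{u} (SkewMonoidAlgebra S G))ᵒᵖ ⥤
    ModuleCat.{u} (SkewMonoidAlgebra S G) where
  obj M := ofAction (Module.Dual S M.unop) (dualAct M.unop) (dualAct_smul M.unop)
  map f := ofActionHom (LinearMap.dualMap (homBase f.unop)) (fun g φ => by
    ext n
    simp only [LinearMap.dualMap_apply, dualAct_apply, map_act])
  map_id _ := rfl
  map_comp _ _ := rfl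

end Dual

section Functors

variable (k : Type v) [CommRing k] (S : Type u) [CommRing S] [Algebra k S]
  (G : Type u) [Group G] [MulSemiringAction G S] [SMulCommClass G k S]

/-- The invariant ring `R = S^G`. -/
abbrev InvRing : Type u := FixedPoints.subalgebra k S G

/-- The `R`-submodule `M^G` of an `S * G`-module `M`. -/
def invariants (M : ModuleCat.{u} (SkewMonoidAlgebra S G)) :
    Submodule (InvRing k S G) M where
  carrier := {m | ∀ g : G, act M g m = m}
  add_mem' {m n} hm hn g := by rw [map_add, hm g, hn g]
  zero_mem' g := (act M g).map_zero
  smul_mem' r m hm g := by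
    change act M g ((r : S) • m) = (r : S) • m
    rw [act_smul, r.2 g, hm g]

/-- The functor `M ↦ M^G` from `S * G`-modules to `R`-modules; a homomorphism is restricted to
the invariants. -/
def invFunctor : ModuleCat.{u} (SkewMonoidAlgebra S G) ⥤ ModuleCat.{u} (InvRing k S G) where
  obj M := ModuleCat.of (InvRing k S G) (invariants k S G M)
  map {M N} f := ModuleCat.ofHom
    (((homBase f).restrictScalars (InvRing k S G)).restrict
      (p := invariants k S G M) (q := invariants k S G N)
      (fun m hm g => (map_act f g m).symm.trans (congrArg (homBase f) (hm g))))
  map_id _ := rfl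
  map_comp _ _ := rfl

/-- The action of `g ∈ G` on `S` as an `R`-linear map. -/
def actS (g : G) : S →ₗ[InvRing k S G] S where
  toFun s := g • s
  map_add' := smul_add g
  map_smul' r s := by
    change g • ((r : S) * s) = (r : S) * g • s
    rw [smul_mul', r.2 g]

/-- The action of `G` on `S ⊗_R N`: `g(s ⊗ n) = g(s) ⊗ n`. -/
def tensorAct (N : ModuleCat.{u} (InvRing k S G)) :
    G →* AddMonoid.End (TensorProduct (InvRing k S G) S N) where
  toFun g := (LinearMap.rTensor N (actS k S G g)).toAddMonoidHom
  map_one' := by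
    have : actS k S G 1 = LinearMap.id := by ext s; exact one_smul G s
    rw [this, LinearMap.rTensor_id]
    rfl
  map_mul' g h := by
    have : actS k S G (g * h) = actS k S G g ∘ₗ actS k S G h := by ext s; exact mul_smul g h s
    rw [this, LinearMap.rTensor_comp]
    rfl

theorem tensorAct_tmul (N : ModuleCat.{u} (InvRing k S G)) (g : G) (s : S) (n : N) :
    tensorAct k S G N g (TensorProduct.tmul _ s n) = TensorProduct.tmul _ (g • s) n := rfl

theorem tensorAct_smul (N : ModuleCat.{u} (InvRing k S G)) (g : G) (s : S)
    (x : TensorProduct (InvRing k S G) S N) :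
    tensorAct k S G N g (s • x) = (g • s) • tensorAct k S G N g x := by
  induction x with
  | zero => simp
  | tmul t n =>
    rw [TensorProduct.smul_tmul', tensorAct_tmul, tensorAct_tmul, TensorProduct.smul_tmul',
      smul_eq_mul, smul_eq_mul, smul_mul']
  | add x y hx hy => rw [smul_add, map_add, hx, hy, map_add, smul_add]

/-- The functor `N ↦ S ⊗_R N`, `ψ ↦ id_S ⊗ ψ` from `R`-modules to `S * G`-modules. -/
def tensorFunctor : ModuleCat.{u} (InvRing k S G) ⥤ ModuleCat.{u} (SkewMonoidAlgebra S G) where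
  obj N := ofAction (TensorProduct (InvRing k S G) S N) (tensorAct k S G N)
    (tensorAct_smul k S G N)
  map {N₁ N₂} ψ := ofActionHom (TensorProduct.AlgebraTensorModule.lTensor S S ψ.hom)
    (fun g x => by
      induction x with
      | zero => simp
      | tmul t n => rfl
      | add x y hx hy => rw [map_add, map_add, hx, hy, map_add, map_add])
  map_id N := by
    ext x
    exact DFunLike.congr_fun (TensorProduct.AlgebraTensorModule.lTensor_id
      (R := InvRing k S G) (A := S) (M := S) (N := N)) x
  map_comp f g := by
    ext x
    exact DFunLike.congr_fun (TensorProduct.AlgebraTensorModule.lTensor_comp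
      (R := InvRing k S G) (A := S) (M := S) g.hom f.hom) x

/-- The functor `N ↦ (S ⊗_R N)^{**}`, `ψ ↦ (id_S ⊗ ψ)^{**}`, with `(-)^* = Hom_S(-, S)`. -/
def reflTensorFunctor :
    ModuleCat.{u} (InvRing k S G) ⥤ ModuleCat.{u} (SkewMonoidAlgebra S G) :=
  tensorFunctor k S G ⋙ (dualFunctor S G).rightOp ⋙ dualFunctor S G

end Functors

/-- `Ref(R)`: the finitely generated reflexive `R`-modules. -/
def IsRef (R : Type u) [CommRing R] : ObjectProperty (ModuleCat.{u} R) :=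
  fun N => Module.Finite R N ∧ Module.IsReflexive R N

/-- `Ref(S * G)`: the finitely generated `S * G`-modules that are reflexive as `S`-modules. -/
def IsRefSkew (S : Type u) [CommRing S] (G : Type u) [Group G] [MulSemiringAction G S] :
    ObjectProperty (ModuleCat.{u} (SkewMonoidAlgebra S G)) :=
  fun M => Module.Finite (SkewMonoidAlgebra S G) M ∧ Module.IsReflexive S M

end AuslanderRef

end

noncomputable section

/-! Everything rests on the multiplication map S ⊗_R M^G → M (`invMul`). Its kernel and cokernel are
killed by the homological different D: if x in S ⊗_R S dies under every twisted multiplication s ⊗ t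
↦ s g(t) with g ≠ 1 and has product d, then m ↦ ∑ u ⊗ Tr(t m), for x = ∑ u ⊗ t, inverts `invMul` up
to the factor d (`invMul_transfer`, `transfer_invMul`). An explicit x shows that D lies in no prime
with trivial inertia group (`not_homDifferent_le`), and unramifiedness together with invertibility
of |G| makes inertia trivial at height one (`exists_smul_sub_notMem`). So D has codimension at least
two, and by Hartogs over the normal domain S the dual of `invMul` is bijective
(`dualMap_bijective_of_codim_two`).

One composite is then M ≅ M^{**} ≅ (S ⊗_R M^G)^{**}. For the other, bijectivity of that dual gives
(M^*)^G ≅ Hom_R(M^G, R) for every M (`restrictDual_bijective`), while ((S ⊗_R N)^*)^G ≅ Hom_R(N, R)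
is tensor-hom adjunction. Together they identify ((S ⊗_R N)^{**})^G with N^{**}, which is N. Applied
to M and to M^*, the first also shows that M^G is reflexive. -/

namespace AuslanderRef

/-! ### Hartogs' principle over a Noetherian normal domain -/

section Hartogs

variable {S : Type*} [CommRing S] [IsDomain S] [IsNoetherianRing S] [IsIntegrallyClosed S]

/-- In a Noetherian normal domain, a prime of the form `(b : c)` with `b ≠ 0` has height one. -/
theorem height_eq_one_of_forall_mem_iff_dvd {P : Ideal S} [P.IsPrime] {b c : S} (hb : b ≠ 0)
    (hP : ∀ x, x ∈ P ↔ b ∣ x * c) : P.height = 1 := by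
  have hbP : b ∈ P := (hP b).2 (dvd_mul_right b c)
  have hbot : P ≠ ⊥ := fun h => hb (by simpa [h] using hbP)
  -- Otherwise c/b maps the finitely generated nonzero ideal P into itself, so c/b is integral, lies
  -- in S by normality, and 1 ∈ P.
  have hex : ∃ x ∈ P, ∃ y, x * c = b * y ∧ y ∉ P := by
    by_contra! hcon
    let K := FractionRing S
    have hbK : algebraMap S K b ≠ 0 := by simpa using hb
    have hint : IsIntegral S (algebraMap S K c / algebraMap S K b) := by
      refine isIntegral_of_smul_mem_submodule (M := K)
        (N := Submodule.map (Algebra.linearMap S K) P) ?_ ?_ _ ?_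
      · obtain ⟨x, hx, hx0⟩ := Submodule.exists_mem_ne_zero_of_ne_bot hbot
        refine (Submodule.ne_bot_iff _).2 ⟨algebraMap S K x, ⟨x, hx, rfl⟩, by simpa using hx0⟩
      · exact (IsNoetherian.noetherian P).map _
      · rintro _ ⟨x, hx, rfl⟩
        obtain ⟨y, hy⟩ := (hP x).1 hx
        refine ⟨y, hcon x hx y hy, ?_⟩
        have := congrArg (algebraMap S K) hy
        simp only [map_mul] at this
        simp only [Algebra.linearMap_apply, smul_eq_mul]
        rw [div_mul_eq_mul_div, eq_div_iff hbK]
        linear_combination -this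
    obtain ⟨z, hz⟩ := IsIntegrallyClosed.isIntegral_iff.1 hint
    rw [eq_div_iff hbK, ← map_mul] at hz
    have hz' := IsFractionRing.injective S K hz
    refine (Ideal.IsPrime.ne_top ‹_›) ((Ideal.eq_top_iff_one _).2 ((hP 1).2 ⟨z, ?_⟩))
    rw [one_mul, ← hz', mul_comm]
  obtain ⟨x, hx, y, hxy, hy⟩ := hex
  -- For z in P with z c = b w one gets z y = x w, and y ∉ P: locally at P, the ideal is generated
  -- by x. Krull's principal ideal theorem then bounds the height.
  have hmin : P ∈ (Ideal.span {x}).minimalPrimes := by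
    refine ⟨⟨‹_›, by simpa [Ideal.span_le] using hx⟩, ?_⟩
    rintro Q ⟨hQ, hxQ⟩ hQP z hz
    obtain ⟨w, hw⟩ := (hP z).1 hz
    have hzy : z * y = x * w := by
      apply mul_left_cancel₀ hb
      linear_combination (-z) * hxy + x * hw
    have : z * y ∈ Q := by
      rw [hzy]
      exact Q.mul_mem_right _ (hxQ (Ideal.mem_span_singleton_self x))
    exact (hQ.mem_or_mem this).resolve_right fun h => hy (hQP h)
  refine le_antisymm (Ideal.height_le_one_of_isPrincipal_of_mem_minimalPrimes _ P hmin) ?_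
  rw [Order.one_le_iff_ne_zero]
  intro h0
  rw [Ideal.height_eq_zero_iff] at h0
  exact hbot (by simpa [IsDomain.minimalPrimes_eq_singleton_bot] using h0)

/-- Hartogs' principle: in a Noetherian normal domain, `a / b` is integral as soon as it is so
after multiplication by every element of an ideal that lies in no prime of height one. -/
theorem dvd_of_forall_mem_dvd_mul {D : Ideal S}
    (hD : ∀ p : Ideal S, p.IsPrime → p.height = 1 → ¬ D ≤ p) {a b : S} (hb : b ≠ 0)
    (h : ∀ d ∈ D, b ∣ d * a) : b ∣ a := by
  by_contra hab
  have hne : Ideal.Quotient.mk (Ideal.span {b}) a ≠ 0 := by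
    rwa [Ne, Ideal.Quotient.eq_zero_iff_mem, Ideal.mem_span_singleton]
  -- The annihilator (b : a) contains D and lies in an associated prime (b : c) of S/(b), which has
  -- height one.
  obtain ⟨P, hPa, hle⟩ := exists_le_isAssociatedPrime_of_isNoetherianRing S _ hne
  obtain ⟨hPp, y, hPy⟩ := isAssociatedPrime_iff.1 hPa
  obtain ⟨c, rfl⟩ := Ideal.Quotient.mk_surjective y
  have hmk : ∀ x z : S, x • Ideal.Quotient.mk (Ideal.span {b}) z = 0 ↔ b ∣ x * z := fun x z => by
    rw [← Ideal.mem_span_singleton, ← Ideal.Quotient.eq_zero_iff_mem]; rfl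
  have hP : ∀ x, x ∈ P ↔ b ∣ x * c := fun x => by
    rw [hPy, Submodule.mem_colon_singleton, Submodule.mem_bot, hmk]
  refine hD P hPp (height_eq_one_of_forall_mem_iff_dvd hb hP) (le_trans ?_ hle)
  intro d hd
  rw [Submodule.mem_colon_singleton, Submodule.mem_bot, hmk]
  exact h d hd

variable {A B : Type*} [AddCommGroup A] [Module S A] [AddCommGroup B] [Module S B]

/-- A linear map whose kernel and cokernel are killed by an ideal of codimension at least two
induces an isomorphism on duals. -/
theorem dualMap_bijective_of_codim_two {D : Ideal S} (hD0 : D ≠ ⊥)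
    (hD : ∀ p : Ideal S, p.IsPrime → p.height = 1 → ¬ D ≤ p) (i : A →ₗ[S] B)
    (hker : ∀ d ∈ D, ∀ a, i a = 0 → d • a = 0)
    (hrange : ∀ d ∈ D, ∀ b, ∃ a, i a = d • b) : Function.Bijective i.dualMap := by
  obtain ⟨d₀, hd₀, hne⟩ := Submodule.exists_mem_ne_zero_of_ne_bot hD0
  constructor
  · rw [injective_iff_map_eq_zero]
    intro φ hφ
    ext b
    obtain ⟨a, ha⟩ := hrange d₀ hd₀ b
    have : d₀ * φ b = 0 := by
      rw [← smul_eq_mul, ← map_smul, ← ha]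
      exact LinearMap.congr_fun hφ a
    simpa [hne] using this
  · intro f
    have hfker : ∀ a, i a = 0 → f a = 0 := fun a ha => by
      have := congrArg f (hker d₀ hd₀ a ha)
      simpa [hne] using this
    have hwd : ∀ a a', i a = i a' → f a = f a' := fun a a' h => by
      rw [← sub_eq_zero, ← map_sub]
      exact hfker _ (by rw [map_sub, h, sub_self])
    -- The extension of f has to be b ↦ f(j b)/d₀. Hartogs supplies the division: if i a = d b, then
    -- d f(j b) = d₀ f(a).
    choose j hj using hrange d₀ hd₀
    have hdvd : ∀ b, d₀ ∣ f (j b) := fun b => by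
      refine dvd_of_forall_mem_dvd_mul hD hne fun d hd => ?_
      obtain ⟨a, ha⟩ := hrange d hd b
      refine ⟨f a, ?_⟩
      rw [← smul_eq_mul, ← smul_eq_mul, ← map_smul, ← map_smul]
      apply hwd
      rw [map_smul, map_smul, hj, ha, smul_comm]
    choose F hF using hdvd
    refine ⟨⟨⟨F, fun b b' => ?_⟩, fun s b => ?_⟩, ?_⟩
    · apply mul_left_cancel₀ hne
      rw [mul_add, ← hF, ← hF, ← hF, ← map_add]
      apply hwd
      rw [map_add, hj, hj, hj, smul_add]
    · apply mul_left_cancel₀ hne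
      simp only [RingHom.id_apply, smul_eq_mul]
      rw [mul_left_comm, ← hF, ← hF, ← smul_eq_mul, ← map_smul]
      apply hwd
      rw [map_smul, hj, hj, smul_comm]
    · ext a
      apply mul_left_cancel₀ hne
      change d₀ * F (i a) = d₀ * f a
      rw [← hF, ← smul_eq_mul, ← map_smul]
      apply hwd
      rw [map_smul, hj]

end Hartogs

/-! ### Duals of finitely generated modules are reflexive -/

section DualReflexive

variable {S : Type*} [CommRing S] [IsDomain S] {A : Type*} [AddCommGroup A] [Module S A]

/-- A finitely generated module over a domain is, up to torsion, a free module. -/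
theorem exists_free_comp_eq_smul [Module.Finite S A] :
    ∃ (n : Type) (_ : Finite n) (c : S) (_ : c ≠ 0) (i : (n →₀ S) →ₗ[S] A)
      (j : A →ₗ[S] (n →₀ S)), i ∘ₗ j = c • LinearMap.id := by
  obtain ⟨n, v, hv⟩ := Module.Finite.exists_fin (R := S) (M := A)
  -- Each generator has a nonzero multiple in the span of a maximal independent subfamily; c is the
  -- product of these multipliers.
  obtain ⟨s, hs, hmax⟩ := exists_maximal_linearIndepOn S v
  have hex : ∀ t, ∃ a : S, a ≠ 0 ∧ a • v t ∈ Submodule.span S (v '' s) := fun t => by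
    by_cases ht : t ∈ s
    · exact ⟨1, one_ne_zero, by
        rw [one_smul]; exact Submodule.subset_span ⟨t, ht, rfl⟩⟩
    · exact hmax t ht
  choose a ha hav using hex
  let i : (s →₀ S) →ₗ[S] A := Finsupp.linearCombination S (fun t : s => v t)
  have hi : Function.Injective i := hs
  have hri : LinearMap.range i = Submodule.span S (v '' s) := by
    rw [Finsupp.range_linearCombination, Set.image_eq_range]
  have hmem : ∀ x : A, (∏ t, a t) • x ∈ LinearMap.range i := fun x => by
    have hx : x ∈ Submodule.span S (Set.range v) := hv ▸ Submodule.mem_top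
    rw [hri]
    induction hx using Submodule.span_induction with
    | mem x hx =>
      obtain ⟨t, rfl⟩ := hx
      rw [← Finset.mul_prod_erase _ _ (Finset.mem_univ t), mul_comm, mul_smul]
      exact Submodule.smul_mem _ _ (hav t)
    | zero => simp
    | add x y _ _ hx hy => rw [smul_add]; exact add_mem hx hy
    | smul r x _ hx => rw [smul_comm]; exact Submodule.smul_mem _ _ hx
  refine ⟨s, inferInstance, ∏ t, a t, Finset.prod_ne_zero_iff.2 fun t _ => ha t, i,
    (LinearEquiv.ofInjective i hi).symm ∘ₗ
      LinearMap.codRestrict (LinearMap.range i) ((∏ t, a t) • LinearMap.id) hmem, ?_⟩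
  ext x
  simp only [LinearMap.comp_apply, LinearEquiv.coe_coe]
  rw [← LinearEquiv.ofInjective_apply (h := hi), LinearEquiv.apply_symm_apply]
  rfl

/-- The dual of a finitely generated module over a domain is reflexive. -/
theorem isReflexive_dual [Module.Finite S A] : Module.IsReflexive S (Module.Dual S A) := by
  obtain ⟨n, _, c, hc, i, j, hij⟩ := exists_free_comp_eq_smul (S := S) (A := A)
  -- A functional on A^{**} that vanishes on A is zero: c • ψ factors through the bidual of a free
  -- module of finite rank, whose elements all come from the module itself.
  have hinj : ∀ Φ : Module.Dual S (Module.Dual S (Module.Dual S A)),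
      (∀ a, Φ (Module.Dual.eval S A a) = 0) → Φ = 0 := fun Φ hΦ => by
    have hi : ∀ ξ, Φ (i.dualMap.dualMap ξ) = 0 := fun ξ => by
      obtain ⟨y, rfl⟩ := (Module.bijective_dual_eval S (n →₀ S)).2 ξ
      exact hΦ (i y)
    ext ψ
    have hcψ : i.dualMap.dualMap (j.dualMap.dualMap ψ) = c • ψ := by
      ext φ
      change ψ ((φ ∘ₗ i) ∘ₗ j) = c • ψ φ
      rw [LinearMap.comp_assoc, hij, LinearMap.comp_smul, map_smul, LinearMap.comp_id]
    have := hi (j.dualMap.dualMap ψ)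
    rw [hcψ, map_smul, smul_eq_mul] at this
    simpa [hc] using this
  -- Restricting along A → A^{**} retracts A^* → A^{***}; `hinj` says that this restriction is
  -- injective.
  refine ⟨⟨fun φ φ' h => ?_, fun Φ => ⟨Φ ∘ₗ Module.Dual.eval S A, ?_⟩⟩⟩
  · ext a
    exact LinearMap.congr_fun h (Module.Dual.eval S A a)
  · rw [← sub_eq_zero]
    apply hinj
    intro a
    simp

end DualReflexive

/-! ### Integral and essentially of finite type implies finite -/

section Finiteness

/-- An integral algebra that is essentially of finite type is finite. -/
theorem finite_of_isIntegral_of_essFiniteType (A B : Type*) [CommRing A] [CommRing B] [Algebra A B]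
    [Algebra.IsIntegral A B] [h : Algebra.EssFiniteType A B] : Module.Finite A B := by
  obtain ⟨σ, hσ⟩ := (Algebra.essFiniteType_iff A B).1 h
  have hint : Algebra.IsIntegral (Algebra.adjoin A (σ : Set B)) B := Algebra.IsIntegral.tower_top A
  have htop : Algebra.adjoin A (σ : Set B) = ⊤ := by
    rw [eq_top_iff]
    intro s _
    obtain ⟨t, ht, htu, hst⟩ := hσ s
    -- Units descend along the integral inclusion of the subalgebra, so no denominators are needed
    -- beyond it.
    have hu : IsUnit (⟨t, ht⟩ : Algebra.adjoin A (σ : Set B)) :=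
      isUnit_of_map_unit (algebraMap (Algebra.adjoin A (σ : Set B)) B) _ htu
    obtain ⟨w, hw⟩ := hu.exists_right_inv
    have hw' : t * (w : B) = 1 := congrArg Subtype.val hw
    have := mul_mem hst w.2
    rwa [mul_assoc, hw', mul_one] at this
  have : Algebra.FiniteType A B := ⟨⟨σ, htop⟩⟩
  exact Algebra.IsIntegral.finite

end Finiteness

/-! ### Triviality of inertia groups -/

section Inertia

variable (k : Type v) [CommRing k] {S : Type u} [CommRing S] [Algebra k S]
  {G : Type u} [Group G] [MulSemiringAction G S] [SMulCommClass G k S]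

variable [IsDomain S] [IsNoetherianRing S]

/-- If `𝔭` is generated by invariants locally at `𝔭` and the order of `G` is invertible, then the
inertia group of `𝔭` is trivial. -/
theorem exists_smul_sub_notMem [Finite G] [FaithfulSMul G S] (hG : IsUnit (Nat.card G : S))
    (p : Ideal S) [p.IsPrime]
    (hp : ∀ a ∈ p, ∃ t ∉ p,
      t * a ∈ (p.comap (algebraMap (InvRing k S G) S)).map (algebraMap (InvRing k S G) S))
    {h : G} (hne : h ≠ 1) : ∃ a : S, h • a - a ∉ p := by
  classical
  by_contra! hcon
  cases nonempty_fintype G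
  let I : Subgroup G := AddSubgroup.inertia p.toAddSubgroup G
  cases nonempty_fintype I
  set q := p.comap (algebraMap (InvRing k S G) S)
  have hI : ∀ (σ : I) (a : S), (σ : G) • a - a ∈ p := fun σ a => σ.2 a
  have hcard : IsUnit (Fintype.card I : S) := by
    rw [← Nat.card_eq_fintype_card]
    exact isUnit_of_dvd_unit (Nat.cast_dvd_cast (Subgroup.card_subgroup_dvd_card I)) hG
  -- E is |I| times the projection complementary to averaging over the inertia group I. The aim is E
  -- = 0, which forces I to act trivially.
  let E : S → S := fun a => ∑ σ : I, (a - (σ : G) • a)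
  have hE_add : ∀ a b, E (a + b) = E a + E b := fun a b => by
    simp only [E, ← Finset.sum_add_distrib]
    exact Finset.sum_congr rfl fun σ _ => by rw [smul_add]; ring
  have hE_mul : ∀ t a : S, (∀ σ : I, (σ : G) • t = t) → E (t * a) = t * E a := fun t a ht => by
    simp only [E, Finset.mul_sum]
    exact Finset.sum_congr rfl fun σ _ => by rw [smul_mul', ht]; ring
  have hE_mem : ∀ a, E a ∈ p := fun a => p.sum_mem fun σ _ => by
    rw [← neg_mem_iff, neg_sub]
    exact hI σ a
  have hE_eq : ∀ a, E a = (Fintype.card I : S) * a - ∑ σ : I, (σ : G) • a := fun a => by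
    simp [E, Finset.sum_sub_distrib]
  have hsum : ∀ (τ : I) (a : S), (τ : G) • ∑ σ : I, (σ : G) • a = ∑ σ : I, (σ : G) • a := fun τ a => by
    rw [Finset.smul_sum]
    refine Fintype.sum_equiv (Equiv.mulLeft τ) _ _ fun σ => ?_
    simp [mul_smul]
  have hE_one : ∀ a, (∀ σ : I, (σ : G) • a = a) → E a = 0 := fun a ha => by
    simp [E, ha]
  have hEE : ∀ a, E (E a) = (Fintype.card I : S) * E a := fun a => by
    have hsub : E (E a) + E (∑ σ : I, (σ : G) • a) = E ((Fintype.card I : S) * a) := by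
      rw [← hE_add]
      congr 1
      rw [hE_eq a]; ring
    rw [hE_one _ (fun τ => hsum τ a), add_zero] at hsub
    rw [hsub, hE_mul]
    intro σ
    exact map_natCast (MulSemiringAction.toRingHom G S (σ : G)) _
  -- The norm of t over I is I-invariant, and it stays outside p because σ(t) ≡ t mod p.
  have hloc : ∀ a ∈ p, ∃ t ∉ p, (∀ σ : I, (σ : G) • t = t) ∧
      t * a ∈ q.map (algebraMap (InvRing k S G) S) := fun a ha => by
    obtain ⟨t, ht, hta⟩ := hp a ha
    refine ⟨∏ σ : I, (σ : G) • t, fun hmem => ?_, fun τ => ?_, ?_⟩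
    · obtain ⟨σ, -, hσ⟩ := Ideal.IsPrime.prod_mem_iff.1 hmem
      refine ht ?_
      have := p.sub_mem hσ (hI σ t)
      rwa [sub_sub_cancel] at this
    · rw [Finset.smul_prod']
      refine Fintype.prod_equiv (Equiv.mulLeft τ) _ _ fun σ => ?_
      simp [mul_smul]
    · rw [← Finset.prod_erase_mul _ _ (Finset.mem_univ (1 : I)), mul_assoc]
      apply Ideal.mul_mem_left
      simpa using hta
  -- E gains a power of q: for r in q^n, E(s r) = r E(s), and E(s) ∈ p lies in q S up to a
  -- multiplier outside p.
  have hstep : ∀ n : ℕ, ∀ y ∈ (q ^ n).map (algebraMap (InvRing k S G) S), ∀ s : S, ∃ t ∉ p,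
      (∀ σ : I, (σ : G) • t = t) ∧
        t * E (s * y) ∈ (q ^ (n + 1)).map (algebraMap (InvRing k S G) S) := fun n y hy => by
    refine Submodule.span_induction (p := fun y _ => ∀ s : S, ∃ t ∉ p,
      (∀ σ : I, (σ : G) • t = t) ∧
        t * E (s * y) ∈ (q ^ (n + 1)).map (algebraMap (InvRing k S G) S)) ?_ ?_ ?_ ?_ hy
    · rintro _ ⟨r, hr, rfl⟩ s
      obtain ⟨t, ht, htI, hmem⟩ := hloc (E s) (hE_mem s)
      refine ⟨t, ht, htI, ?_⟩
      rw [mul_comm s, hE_mul (algebraMap _ S r) _ (fun σ => r.2 σ), mul_left_comm, pow_succ, Ideal.map_mul]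
      exact Ideal.mul_mem_mul (Ideal.mem_map_of_mem _ hr) hmem
    · intro s
      refine ⟨1, (Ideal.ne_top_iff_one p).1 (Ideal.IsPrime.ne_top ‹_›), fun σ => smul_one _, ?_⟩
      rw [mul_zero, hE_one 0 (fun σ => smul_zero _), mul_zero]
      exact zero_mem _
    · intro x y _ _ hx hy s
      obtain ⟨t, ht, htI, htx⟩ := hx s
      obtain ⟨t', ht', htI', hty⟩ := hy s
      refine ⟨t * t', fun hmem => ((Ideal.IsPrime.mem_or_mem ‹_› hmem).elim ht ht'),
        fun σ => by rw [smul_mul', htI, htI'], ?_⟩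
      rw [mul_add, hE_add, mul_add]
      refine add_mem ?_ ?_
      · rw [mul_comm t, mul_assoc]
        exact Ideal.mul_mem_left _ _ htx
      · rw [mul_assoc]
        exact Ideal.mul_mem_left _ _ hty
    · intro s' y _ hy s
      rw [smul_eq_mul, ← mul_assoc]
      exact hy (s * s')
  -- Since E² = |I| E with |I| a unit, applying E again lifts E(a) into ever higher powers of q.
  have hpow : ∀ (n : ℕ) (a : S), ∃ t ∉ p, (∀ σ : I, (σ : G) • t = t) ∧
      t * E a ∈ (q ^ n).map (algebraMap (InvRing k S G) S) := fun n => by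
    induction n with
    | zero =>
      intro a
      refine ⟨1, (Ideal.ne_top_iff_one p).1 (Ideal.IsPrime.ne_top ‹_›), fun σ => smul_one _, ?_⟩
      rw [pow_zero, Ideal.one_eq_top, Ideal.map_top]
      exact Submodule.mem_top
    | succ n ih =>
      intro a
      obtain ⟨t, ht, htI, hta⟩ := ih a
      obtain ⟨t', ht', htI', hmem⟩ := hstep n _ hta 1
      refine ⟨t' * t, fun hmem => ((Ideal.IsPrime.mem_or_mem ‹_› hmem).elim ht' ht),
        fun σ => by rw [smul_mul', htI, htI'], ?_⟩
      rw [one_mul, hE_mul _ _ htI, hEE] at hmem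
      rw [← Ideal.unit_mul_mem_iff_mem _ hcard]
      convert hmem using 1
      ring
  -- Krull's intersection theorem in S_p.
  have hE_zero : ∀ a, E a = 0 := fun a => by
    apply IsLocalization.injective (Localization.AtPrime p) p.primeCompl_le_nonZeroDivisors
    rw [map_zero, ← Ideal.mem_bot, ← Ideal.iInf_pow_eq_bot_of_isLocalRing
      (IsLocalRing.maximalIdeal (Localization.AtPrime p)) Ideal.IsPrime.ne_top', Ideal.mem_iInf]
    intro n
    obtain ⟨t, ht, -, hta⟩ := hpow n a
    have hle : (q ^ n).map (algebraMap (InvRing k S G) S) ≤ p ^ n := by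
      rw [Ideal.map_pow]
      exact Ideal.pow_right_mono Ideal.map_comap_le n
    have hmem := Ideal.mem_map_of_mem (algebraMap S (Localization.AtPrime p)) (hle hta)
    rw [Ideal.map_pow, Localization.AtPrime.map_eq_maximalIdeal, map_mul] at hmem
    rwa [Ideal.unit_mul_mem_iff_mem _ (IsLocalization.map_units (Localization.AtPrime p)
      (⟨t, ht⟩ : p.primeCompl))] at hmem
  refine hne (eq_of_smul_eq_smul (α := S) fun a => ?_)
  have hsa := hsum ⟨h, hcon⟩ a
  have hna := hE_eq a
  rw [hE_zero, eq_comm, sub_eq_zero] at hna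
  rw [← hna] at hsa
  have hc : h • (Fintype.card I : S) = Fintype.card I :=
    map_natCast (MulSemiringAction.toRingHom G S h) _
  rw [smul_mul', hc] at hsa
  rw [one_smul]
  exact hcard.mul_left_cancel hsa

end Inertia

/-! ### The homological different -/

section Different

open TensorProduct

variable (k : Type v) [CommRing k] (S : Type u) [CommRing S] [Algebra k S]
  (G : Type u) [Group G] [MulSemiringAction G S] [SMulCommClass G k S]

/-- The homomorphism `S ⊗_R S → S`, `s ⊗ t ↦ s g(t)`. -/
def twistedMul (g : G) : S ⊗[InvRing k S G] S →+* S :=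
  (Algebra.TensorProduct.productMap (AlgHom.id _ S)
    (MulSemiringAction.toAlgHom (InvRing k S G) S g)).toRingHom

@[simp]
theorem twistedMul_tmul (g : G) (s t : S) : twistedMul k S G g (s ⊗ₜ t) = s * g • t := by
  exact Algebra.TensorProduct.productMap_apply_tmul _ _ s t

/-- The homological different of `S` over `S^G`, relative to `G`. -/
def homDifferent : Ideal S :=
  (⨅ g : {g : G // g ≠ 1}, RingHom.ker (twistedMul k S G g)).map (twistedMul k S G 1)

theorem mem_homDifferent {d : S} : d ∈ homDifferent k S G ↔
    ∃ x, (∀ g : G, g ≠ 1 → twistedMul k S G g x = 0) ∧ twistedMul k S G 1 x = d := by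
  rw [homDifferent, Ideal.mem_map_iff_of_surjective]
  · simp [RingHom.mem_ker]
  · intro s
    exact ⟨s ⊗ₜ 1, by simp⟩

/-- The homological different lies in no prime with trivial inertia group. -/
theorem not_homDifferent_le [Finite G] (p : Ideal S) [p.IsPrime]
    (hp : ∀ h : G, h ≠ 1 → ∃ a : S, h • a - a ∉ p) : ¬ homDifferent k S G ≤ p := by
  classical
  cases nonempty_fintype G
  have hex : ∀ h : G, ∃ a : S, h ≠ 1 → h • a - a ∉ p := fun h => by
    by_cases h1 : h = 1
    · exact ⟨0, fun hne => (hne h1).elim⟩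
    · obtain ⟨a, ha⟩ := hp h h1
      exact ⟨a, fun _ => ha⟩
  choose a ha using hex
  intro hle
  -- The factor at h dies under the twist by h, and under plain multiplication it becomes h(a_h) -
  -- a_h, which is outside p.
  let x : S ⊗[InvRing k S G] S :=
    ∏ h ∈ Finset.univ.erase (1 : G), ((h • a h) ⊗ₜ 1 - 1 ⊗ₜ (a h))
  have hx : ∀ g : G, twistedMul k S G g x =
      ∏ h ∈ Finset.univ.erase (1 : G), (h • a h - g • a h) := fun g => by
    simp [x, map_prod]
  have hmem := hle ((mem_homDifferent k S G).2 ⟨x, fun g hg => ?_, rfl⟩)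
  · rw [hx] at hmem
    obtain ⟨h, hh, hmem⟩ := Ideal.IsPrime.prod_mem_iff.1 hmem
    rw [one_smul] at hmem
    exact ha h (Finset.ne_of_mem_erase hh) hmem
  · rw [hx]
    exact Finset.prod_eq_zero (Finset.mem_erase.2 ⟨hg, Finset.mem_univ g⟩) (sub_self _)

/-- Faithfulness says that the zero prime has trivial inertia group. -/
theorem homDifferent_ne_bot [IsDomain S] [Finite G] [FaithfulSMul G S] :
    homDifferent k S G ≠ ⊥ := by
  intro hbot
  refine not_homDifferent_le k S G ⊥ (fun h hne => ?_) hbot.le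
  by_contra! hcon
  refine hne (eq_of_smul_eq_smul (α := S) fun a => ?_)
  rw [one_smul]
  exact sub_eq_zero.1 (hcon a)

/-- Clears denominators in the equality q B_p = p B_p, using that B embeds in B_p. -/
theorem exists_mul_mem_map_of_isUnramifiedLocalHom {A B : Type*} [CommRing A] [CommRing B]
    [IsDomain B] [Algebra A B] (p : Ideal B) [p.IsPrime]
    (h : IsUnramifiedLocalHom (Localization.localRingHom (p.comap (algebraMap A B)) p
        (algebraMap A B) rfl)) {a : B} (ha : a ∈ p) :
    ∃ t ∉ p, t * a ∈ (p.comap (algebraMap A B)).map (algebraMap A B) := by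
  have hmem : algebraMap B (Localization.AtPrime p) a ∈
      ((p.comap (algebraMap A B)).map (algebraMap A B)).map
        (algebraMap B (Localization.AtPrime p)) := by
    have h1 := h.1
    rw [← Localization.AtPrime.map_eq_maximalIdeal, ← Localization.AtPrime.map_eq_maximalIdeal,
      Ideal.map_map] at h1
    rw [Ideal.map_map]
    have hcomp : (Localization.localRingHom (p.comap (algebraMap A B)) p (algebraMap A B)
        rfl).comp (algebraMap A (Localization.AtPrime (p.comap (algebraMap A B)))) =
        (algebraMap B (Localization.AtPrime p)).comp (algebraMap A B) := by
      ext x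
      exact Localization.localRingHom_to_map _ _ _ rfl x
    rw [← hcomp, h1]
    exact Ideal.mem_map_of_mem _ ha
  obtain ⟨⟨y, t⟩, hyt⟩ := (IsLocalization.mem_map_algebraMap_iff p.primeCompl _).1 hmem
  rw [← map_mul] at hyt
  have := IsLocalization.injective (Localization.AtPrime p) p.primeCompl_le_nonZeroDivisors hyt
  refine ⟨t, t.2, ?_⟩
  rw [mul_comm, this]
  exact y.2

/-- If `S^G → S` is unramified in codimension one and the order of `G` is invertible, then the
homological different lies in no prime of height one. -/
theorem not_homDifferent_le_of_height_eq_one [IsDomain S] [IsNoetherianRing S] [Finite G]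
    [FaithfulSMul G S] (hG : IsUnit (Nat.card G : S))
    (hunr : UnramifiedInCodimOne (InvRing k S G) S) (p : Ideal S) (hp : p.IsPrime)
    (h1 : p.height = 1) : ¬ homDifferent k S G ≤ p :=
  not_homDifferent_le k S G p fun _ hne => exists_smul_sub_notMem k hG p
    (fun _ ha => exists_mul_mem_map_of_isUnramifiedLocalHom p (hunr.2 p h1) ha) hne

/-- S is integral over its invariants, each s being a root of ∏ (X - g(s)). -/
theorem finite_of_unramifiedInCodimOne [Finite G] (hunr : UnramifiedInCodimOne (InvRing k S G) S) :
    Module.Finite (InvRing k S G) S := by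
  have : Algebra.IsInvariant (InvRing k S G) S G := ⟨fun b hb => ⟨⟨b, hb⟩, rfl⟩⟩
  have := Algebra.IsInvariant.isIntegral (InvRing k S G) S G
  have := hunr.1
  exact finite_of_isIntegral_of_essFiniteType _ _

end Different

/-! ### Modules over the skew group ring -/

section SkewModules

variable {S : Type u} [CommRing S] {G : Type u} [Group G] [MulSemiringAction G S]

theorem single_smul (M : ModuleCat.{u} (SkewMonoidAlgebra S G)) (g : G) (s : S) (m : M) :
    SkewMonoidAlgebra.single g s • m = s • act M g m := by
  rw [act_apply, smul_def, ← mul_smul]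
  simp [SkewMonoidAlgebra.single_mul_single]

/-- An `S`-linear map between `S * G`-modules that commutes with `G` is `S * G`-linear. -/
def homOfCommutes {M N : ModuleCat.{u} (SkewMonoidAlgebra S G)} (f : M →ₗ[S] N)
    (hf : ∀ g m, f (act M g m) = act N g (f m)) : M ⟶ N :=
  ModuleCat.ofHom
    { toFun := f
      map_add' := f.map_add
      map_smul' := fun a m => by
        induction a using SkewMonoidAlgebra.induction_on with
        | zero => simp
        | single g s =>
          rw [single_smul, map_smul, hf, RingHom.id_apply, single_smul]
        | add a b ha hb =>
          rw [add_smul, map_add, ha, hb]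
          simp [add_smul] }

section OfAction

variable {A : Type u} [AddCommGroup A] [Module S A] (ρ : G →* AddMonoid.End A)
  (h : ∀ (g : G) (s : S) (a : A), ρ g (s • a) = (g • s) • ρ g a)

/-- The identity, as an `S`-linear equivalence from `A` to the `S * G`-module on `A`. -/
def ofActionEquiv : A ≃ₗ[S] (ofAction A ρ h : ModuleCat.{u} (SkewMonoidAlgebra S G)) where
  toFun a := a
  invFun a := a
  left_inv _ := rfl
  right_inv _ := rfl
  map_add' _ _ := rfl
  map_smul' s a := by
    refine Eq.symm ((single_smul_ofAction A ρ h 1 s a).trans ?_)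
    rw [map_one]
    rfl

theorem act_ofActionEquiv (g : G) (a : A) :
    act (ofAction A ρ h) g (ofActionEquiv ρ h a) = ofActionEquiv ρ h (ρ g a) :=
  (single_smul_ofAction A ρ h g 1 a).trans (one_smul S _)

end OfAction

/-- A finitely generated `S * G`-module is finitely generated over `S`, if `G` is finite. -/
theorem finite_base [Finite G] (M : ModuleCat.{u} (SkewMonoidAlgebra S G))
    [hM : Module.Finite (SkewMonoidAlgebra S G) M] : Module.Finite S M := by
  cases nonempty_fintype G
  obtain ⟨n, v, hv⟩ := Module.Finite.exists_fin (R := SkewMonoidAlgebra S G) (M := M)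
  refine Module.finite_def.2
    ⟨(Set.finite_range fun x : Fin n × G => act M x.2 (v x.1)).toFinset, ?_⟩
  rw [Set.Finite.coe_toFinset, eq_top_iff]
  -- The S-span of all G-translates of the generators is G-stable, hence an S * G-submodule.
  set W := Submodule.span S (Set.range fun x : Fin n × G => act M x.2 (v x.1))
  have hstable : ∀ g : G, ∀ w ∈ W, act M g w ∈ W := fun g w hw => by
    induction hw using Submodule.span_induction with
    | mem w hw =>
      obtain ⟨⟨i, h⟩, rfl⟩ := hw
      refine Submodule.subset_span ⟨(i, g * h), ?_⟩
      simp only [map_mul]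
      rfl
    | zero => rw [map_zero]; exact zero_mem _
    | add x y _ _ hx hy => rw [map_add]; exact add_mem hx hy
    | smul s x _ hx => rw [act_smul]; exact W.smul_mem _ hx
  intro m _
  have hm : m ∈ Submodule.span (SkewMonoidAlgebra S G) (Set.range v) := hv ▸ Submodule.mem_top
  induction hm using Submodule.span_induction with
  | mem w hw =>
    obtain ⟨i, rfl⟩ := hw
    refine Submodule.subset_span ⟨(i, 1), ?_⟩
    simp only [map_one]
    rfl
  | zero => exact zero_mem _
  | add x y _ _ hx hy => exact add_mem (hx trivial) (hy trivial)
  | smul a x _ hx =>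
    have hx := hx trivial
    induction a using SkewMonoidAlgebra.induction_on with
    | zero => rw [zero_smul]; exact zero_mem _
    | single g s => rw [single_smul]; exact W.smul_mem _ (hstable g _ hx)
    | add a b ha hb => rw [add_smul]; exact add_mem (ha trivial) (hb trivial)

/-- An `S * G`-module that is finitely generated over `S` is so over `S * G`. -/
theorem finite_skew (M : ModuleCat.{u} (SkewMonoidAlgebra S G)) [hM : Module.Finite S M] :
    Module.Finite (SkewMonoidAlgebra S G) M := by
  obtain ⟨n, v, hv⟩ := Module.Finite.exists_fin (R := S) (M := M)
  refine Module.finite_def.2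
    ⟨(Set.finite_range v).toFinset, ?_⟩
  rw [Set.Finite.coe_toFinset, eq_top_iff]
  intro m _
  have hm : m ∈ Submodule.span S (Set.range v) := hv ▸ Submodule.mem_top
  induction hm using Submodule.span_induction with
  | mem w hw => exact Submodule.subset_span hw
  | zero => exact zero_mem _
  | add x y _ _ hx hy => exact add_mem (hx trivial) (hy trivial)
  | smul a x _ hx => exact Submodule.smul_mem _ _ (hx trivial)

end SkewModules

/-! ### The map S ⊗ M^G → M and its inverse up to the different -/

section Invariants

open TensorProduct

variable (k : Type v) [CommRing k] {S : Type u} [CommRing S] [Algebra k S]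
  {G : Type u} [Group G] [MulSemiringAction G S] [SMulCommClass G k S]
  (M : ModuleCat.{u} (SkewMonoidAlgebra S G))

theorem act_invariants_smul (g : G) (s : S) (m : invariants k S G M) :
    act M g (s • (m : M)) = (g • s) • (m : M) := by
  rw [act_smul, m.2 g]

/-- The `S`-linear map `S ⊗_R M^G → M`, `s ⊗ m ↦ s m`. -/
def invMul : S ⊗[InvRing k S G] (invariants k S G M) →ₗ[S] M :=
  LinearMap.liftBaseChange S (invariants k S G M).subtype

@[simp]
theorem invMul_tmul (s : S) (m : invariants k S G M) : invMul k M (s ⊗ₜ m) = s • (m : M) := rfl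

theorem invMul_rTensor_actS (g : G) (x : S ⊗[InvRing k S G] (invariants k S G M)) :
    invMul k M (LinearMap.rTensor (invariants k S G M) (actS k S G g) x) = act M g (invMul k M x) := by
  induction x with
  | zero => simp
  | tmul s m => exact (act_invariants_smul k M g s m).symm
  | add x y hx hy => rw [map_add, map_add, hx, hy, map_add, map_add]

variable [Fintype G]

/-- The trace `M → M^G`. -/
def trace : M →ₗ[InvRing k S G] invariants k S G M where
  toFun m := ⟨∑ g : G, act M g m, fun h => by
    rw [map_sum]
    refine Fintype.sum_equiv (Equiv.mulLeft h) _ _ fun g => ?_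
    rw [Equiv.coe_mulLeft, map_mul]
    rfl⟩
  map_add' m n := by
    ext
    simp [Finset.sum_add_distrib]
  map_smul' r m := by
    ext
    change ∑ g : G, act M g ((r : S) • m) = (r : S) • ∑ g : G, act M g m
    rw [Finset.smul_sum]
    refine Finset.sum_congr rfl fun g _ => ?_
    rw [act_smul, r.2 g]

theorem coe_trace (m : M) : (trace k M m : M) = ∑ g : G, act M g m := rfl

/-- The map `M → S ⊗_R M^G`, `m ↦ ∑ u ⊗ Tr(t m)` for `x = ∑ u ⊗ t` in `S ⊗_R S`. -/
def transfer (x : S ⊗[InvRing k S G] S) (m : M) : S ⊗[InvRing k S G] (invariants k S G M) :=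
  LinearMap.lTensor S
    (trace k M ∘ₗ (LinearMap.toSpanSingleton S M m).restrictScalars (InvRing k S G)) x

theorem transfer_tmul (u t : S) (m : M) :
    transfer k M (u ⊗ₜ t) m = u ⊗ₜ trace k M (t • m) := rfl

theorem transfer_add_left (x y : S ⊗[InvRing k S G] S) (m : M) :
    transfer k M (x + y) m = transfer k M x m + transfer k M y m := map_add _ x y

theorem transfer_zero_left (m : M) : transfer k M 0 m = 0 := map_zero _

theorem transfer_zero (x : S ⊗[InvRing k S G] S) : transfer k M x 0 = 0 := by
  induction x with
  | zero => exact transfer_zero_left k M 0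
  | tmul u t => rw [transfer_tmul, smul_zero, map_zero, tmul_zero]
  | add x y hx hy => rw [transfer_add_left, hx, hy, add_zero]

theorem transfer_add (x : S ⊗[InvRing k S G] S) (m n : M) :
    transfer k M x (m + n) = transfer k M x m + transfer k M x n := by
  induction x with
  | zero => simp [transfer_zero_left]
  | tmul u t => rw [transfer_tmul, smul_add, map_add, tmul_add]; rfl
  | add x y hx hy => rw [transfer_add_left, hx, hy, transfer_add_left, transfer_add_left]; abel

/-- On u ⊗ t this is u Tr(t m) = ∑ u g(t) g(m). When x dies under all nontrivial twists, only the
term at g = 1 survives. -/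
theorem invMul_transfer (x : S ⊗[InvRing k S G] S) (m : M) :
    invMul k M (transfer k M x m) = ∑ g : G, twistedMul k S G g x • act M g m := by
  induction x with
  | zero => simp [transfer_zero_left]
  | tmul u t =>
    rw [transfer_tmul, invMul_tmul, coe_trace, Finset.smul_sum]
    refine Finset.sum_congr rfl fun g _ => ?_
    rw [act_smul, twistedMul_tmul, mul_smul]
  | add x y hx hy =>
    rw [transfer_add_left, map_add, hx, hy, ← Finset.sum_add_distrib]
    refine Finset.sum_congr rfl fun g _ => ?_
    rw [map_add, add_smul]

/-- For invariant m, Tr(t s m) = Tr(t s) m, and the scalar Tr(t s) in R crosses the tensor sign. -/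
theorem transfer_invMul (x : S ⊗[InvRing k S G] S)
    (y : S ⊗[InvRing k S G] (invariants k S G M)) :
    transfer k M x (invMul k M y) =
      ∑ g : G, twistedMul k S G g x • LinearMap.rTensor (invariants k S G M) (actS k S G g) y := by
  induction y with
  | zero => simp [transfer_zero]
  | add y z hy hz =>
    rw [map_add, transfer_add, hy, hz, ← Finset.sum_add_distrib]
    refine Finset.sum_congr rfl fun g _ => ?_
    rw [map_add, smul_add]
  | tmul s m =>
    induction x with
    | zero => simp [transfer_zero_left]
    | add x y hx hy =>
      rw [transfer_add_left, hx, hy, ← Finset.sum_add_distrib]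
      refine Finset.sum_congr rfl fun g _ => ?_
      rw [map_add, add_smul]
    | tmul u t =>
      let r : InvRing k S G := ⟨∑ g : G, g • (t * s), fun h => by
        rw [Finset.smul_sum]
        refine Fintype.sum_equiv (Equiv.mulLeft h) _ _ fun g => ?_
        rw [Equiv.coe_mulLeft, mul_smul]⟩
      have hr : trace k M (t • s • (m : M)) = r • m := by
        ext
        rw [coe_trace]
        change _ = (∑ g : G, g • (t * s)) • (m : M)
        rw [Finset.sum_smul]
        refine Finset.sum_congr rfl fun g _ => ?_
        rw [← mul_smul, act_invariants_smul]
      rw [invMul_tmul, transfer_tmul, hr, ← smul_tmul]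
      have hru : r • u = ∑ g : G, u * (g • t) * (g • s) := by
        change (∑ g : G, g • (t * s)) * u = _
        rw [Finset.sum_mul]
        refine Finset.sum_congr rfl fun g _ => ?_
        rw [smul_mul']
        ring
      rw [hru, sum_tmul]
      refine Finset.sum_congr rfl fun g _ => ?_
      rw [twistedMul_tmul]
      rfl

theorem exists_invMul_eq_smul {d : S} (hd : d ∈ homDifferent k S G) (m : M) :
    ∃ y, invMul k M y = d • m := by
  obtain ⟨x, hx, rfl⟩ := (mem_homDifferent k S G).1 hd
  refine ⟨transfer k M x m, ?_⟩
  rw [invMul_transfer, Finset.sum_eq_single 1]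
  · rw [map_one]
    rfl
  · intro g _ hg
    rw [hx g hg, zero_smul]
  · simp

theorem smul_eq_zero_of_invMul_eq_zero {d : S} (hd : d ∈ homDifferent k S G)
    (y : S ⊗[InvRing k S G] (invariants k S G M)) (hy : invMul k M y = 0) : d • y = 0 := by
  obtain ⟨x, hx, rfl⟩ := (mem_homDifferent k S G).1 hd
  have := transfer_invMul k M x y
  rw [hy, transfer_zero, Finset.sum_eq_single 1] at this
  · have h1 : actS k S G 1 = LinearMap.id := by ext s; exact one_smul G s
    rw [this, h1, LinearMap.rTensor_id, LinearMap.id_apply]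
  · intro g _ hg
    rw [hx g hg, zero_smul]
  · exact fun h => (h (Finset.mem_univ _)).elim

end Invariants

/-! ### Consequences of unramifiedness in codimension one -/

section Hypotheses

variable (k : Type v) [CommRing k] {S : Type u} [CommRing S] [Algebra k S]
  {G : Type u} [Group G] [MulSemiringAction G S] [SMulCommClass G k S] [Finite G]

/-- `M^G` is finitely generated over `R`, for a finitely generated `S * G`-module `M`. -/
theorem finite_invariants (hG : IsUnit (Nat.card G : S))
    (hunr : UnramifiedInCodimOne (InvRing k S G) S)
    (M : ModuleCat.{u} (SkewMonoidAlgebra S G)) [Module.Finite (SkewMonoidAlgebra S G) M] :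
    Module.Finite (InvRing k S G) (invariants k S G M) := by
  cases nonempty_fintype G
  have := finite_of_unramifiedInCodimOne k S G hunr
  have := finite_base M
  have : Module.Finite (InvRing k S G) M := Module.Finite.trans S M
  -- An invariant m is the trace of m/|G|, so M^G is a quotient of M and no Noetherian property of R
  -- is called for.
  refine Module.Finite.of_surjective (trace k M) fun m => ?_
  obtain ⟨c, hc⟩ := hG.exists_left_inv
  have hcg : ∀ g : G, g • c = c := fun g => by
    have h := congrArg (g • ·) hc
    have hn : g • (Nat.card G : S) = Nat.card G :=
      map_natCast (MulSemiringAction.toRingHom G S g) _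
    simp only [smul_mul', smul_one, hn] at h
    exact hG.mul_right_cancel (h.trans hc.symm)
  refine ⟨c • (m : M), ?_⟩
  ext
  rw [coe_trace]
  simp only [act_invariants_smul, hcg]
  rw [Finset.sum_const, Finset.card_univ, ← Nat.card_eq_fintype_card, ← Nat.cast_smul_eq_nsmul S,
    ← mul_smul, mul_comm, hc, one_smul]

variable [IsDomain S] [IsNoetherianRing S] [IsIntegrallyClosed S] [FaithfulSMul G S]

/-- If `S^G → S` is unramified in codimension one, then `S ⊗_R M^G → M` is an isomorphism up to
codimension two. -/
theorem dualMap_invMul_bijective (hG : IsUnit (Nat.card G : S))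
    (hunr : UnramifiedInCodimOne (InvRing k S G) S)
    (M : ModuleCat.{u} (SkewMonoidAlgebra S G)) :
    Function.Bijective (invMul k M).dualMap := by
  cases nonempty_fintype G
  exact dualMap_bijective_of_codim_two (homDifferent_ne_bot k S G)
    (not_homDifferent_le_of_height_eq_one k S G hG hunr) _
    (fun _ hd => smul_eq_zero_of_invMul_eq_zero k M hd)
    (fun _ hd => exists_invMul_eq_smul k M hd)

end Hypotheses

/-! ### Equivariant biduality -/

section Biduality

variable {S : Type u} [CommRing S] {G : Type u} [Group G] [MulSemiringAction G S]

/-- The `S * G`-module `M^*`. -/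
abbrev dualObj (M : ModuleCat.{u} (SkewMonoidAlgebra S G)) :
    ModuleCat.{u} (SkewMonoidAlgebra S G) :=
  (dualFunctor S G).obj (Opposite.op M)

/-- The identity, as an `S`-linear equivalence from `Hom_S(M, S)` to the `S * G`-module `M^*`. -/
def dualObjEquiv (M : ModuleCat.{u} (SkewMonoidAlgebra S G)) :
    Module.Dual S M ≃ₗ[S] dualObj M :=
  ofActionEquiv (dualAct M) (dualAct_smul M)

theorem act_dualObjEquiv (M : ModuleCat.{u} (SkewMonoidAlgebra S G)) (g : G)
    (φ : Module.Dual S M) :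
    act (dualObj M) g (dualObjEquiv M φ) = dualObjEquiv M (dualAct M g φ) :=
  act_ofActionEquiv _ _ g φ

theorem dualObjEquiv_symm_act (M : ModuleCat.{u} (SkewMonoidAlgebra S G)) (g : G)
    (φ : dualObj M) (m : M) :
    (dualObjEquiv M).symm (act (dualObj M) g φ) m =
      g • (dualObjEquiv M).symm φ (act M g⁻¹ m) := by
  obtain ⟨φ, rfl⟩ := (dualObjEquiv M).surjective φ
  rw [act_dualObjEquiv, LinearEquiv.symm_apply_apply, LinearEquiv.symm_apply_apply, dualAct_apply]

/-- The evaluation map `M → M^{**}` as an `S`-linear map. -/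
def evalBidual (M : ModuleCat.{u} (SkewMonoidAlgebra S G)) : M →ₗ[S] dualObj (dualObj M) :=
  (dualObjEquiv (dualObj M)).toLinearMap ∘ₗ (dualObjEquiv M).symm.toLinearMap.dualMap ∘ₗ
    Module.Dual.eval S M

theorem evalBidual_apply (M : ModuleCat.{u} (SkewMonoidAlgebra S G)) (m : M) (φ : dualObj M) :
    (dualObjEquiv (dualObj M)).symm (evalBidual M m) φ = (dualObjEquiv M).symm φ m := rfl

theorem evalBidual_act (M : ModuleCat.{u} (SkewMonoidAlgebra S G)) (g : G) (m : M) :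
    evalBidual M (act M g m) = act (dualObj (dualObj M)) g (evalBidual M m) := by
  apply (dualObjEquiv (dualObj M)).symm.injective
  refine LinearMap.ext fun φ => ?_
  rw [evalBidual_apply, dualObjEquiv_symm_act, evalBidual_apply, dualObjEquiv_symm_act, inv_inv,
    smul_inv_smul]

theorem evalBidual_bijective (M : ModuleCat.{u} (SkewMonoidAlgebra S G))
    [Module.IsReflexive S M] : Function.Bijective (evalBidual M) := by
  have h : (evalBidual M : M → dualObj (dualObj M)) =
      (dualObjEquiv (dualObj M)) ∘ (dualObjEquiv M).symm.dualMap ∘ Module.Dual.eval S M := rfl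
  rw [h]
  exact (dualObjEquiv (dualObj M)).bijective.comp
    ((dualObjEquiv M).symm.dualMap.bijective.comp (Module.bijective_dual_eval S M))

variable (S G)

/-- The bidual functor `M ↦ M^{**}` on `S * G`-modules. -/
abbrev bidualFunctor : ModuleCat.{u} (SkewMonoidAlgebra S G) ⥤
    ModuleCat.{u} (SkewMonoidAlgebra S G) :=
  (dualFunctor S G).rightOp ⋙ dualFunctor S G

/-- The evaluation maps `M → M^{**}` as a natural transformation. -/
def evalBidualNat : 𝟭 (ModuleCat.{u} (SkewMonoidAlgebra S G)) ⟶ bidualFunctor S G where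
  app M := homOfCommutes (evalBidual M) (evalBidual_act M)
  naturality _ _ _ := rfl

variable {S G}

theorem isIso_evalBidualNat_app (M : ModuleCat.{u} (SkewMonoidAlgebra S G))
    [Module.IsReflexive S M] : IsIso ((evalBidualNat S G).app M) := by
  rw [ConcreteCategory.isIso_iff_bijective]
  exact evalBidual_bijective M

theorem isIso_dualFunctor_map {M N : ModuleCat.{u} (SkewMonoidAlgebra S G)} (f : M ⟶ N)
    (hf : Function.Bijective (homBase f).dualMap) : IsIso ((dualFunctor S G).map f.op) := by
  rw [ConcreteCategory.isIso_iff_bijective]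
  exact hf

theorem finite_dualObj [IsNoetherianRing S] (M : ModuleCat.{u} (SkewMonoidAlgebra S G))
    [Module.Finite S M] : Module.Finite S (dualObj M) :=
  have : Module.Finite S (Module.Dual S M) := Module.IsNoetherian.finite S _
  Module.Finite.equiv (dualObjEquiv M)

theorem isReflexive_dualObj [IsDomain S] (M : ModuleCat.{u} (SkewMonoidAlgebra S G))
    [Module.Finite S M] : Module.IsReflexive S (dualObj M) :=
  have : Module.IsReflexive S (Module.Dual S M) := isReflexive_dual
  Module.equiv (dualObjEquiv M)

end Biduality

/-! ### Invariants, base change and duals -/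

section Adjunction

open TensorProduct

variable (k : Type v) [CommRing k] {S : Type u} [CommRing S] [Algebra k S]
  {G : Type u} [Group G] [MulSemiringAction G S] [SMulCommClass G k S]

/-- The identity, as an `S`-linear equivalence. -/
def tensorObjEquiv (N : ModuleCat.{u} (InvRing k S G)) :
    (S ⊗[InvRing k S G] N) ≃ₗ[S] (tensorFunctor k S G).obj N :=
  ofActionEquiv (tensorAct k S G N) (tensorAct_smul k S G N)

theorem act_tensorObjEquiv (N : ModuleCat.{u} (InvRing k S G)) (g : G)
    (x : S ⊗[InvRing k S G] N) :
    act ((tensorFunctor k S G).obj N) g (tensorObjEquiv k N x) =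
      tensorObjEquiv k N (tensorAct k S G N g x) :=
  act_ofActionEquiv _ _ g x

/-- The restriction of a homomorphism to the invariants. -/
def invariantsMap {M N : ModuleCat.{u} (SkewMonoidAlgebra S G)} (f : M ⟶ N) :
    invariants k S G M →ₗ[InvRing k S G] invariants k S G N :=
  ((invFunctor k S G).map f).hom

theorem invMul_lTensor {M N : ModuleCat.{u} (SkewMonoidAlgebra S G)} (f : M ⟶ N)
    (x : S ⊗[InvRing k S G] (invariants k S G M)) :
    invMul k N (LinearMap.lTensor S (invariantsMap k f) x) = homBase f (invMul k M x) := by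
  induction x with
  | zero => simp
  | tmul s m => exact ((homBase f).map_smul s (m : M)).symm
  | add x y hx hy => rw [map_add, map_add, hx, hy, map_add, map_add]

variable (S G) in
/-- The natural map `S ⊗_R M^G → M`. -/
def invMulNat : invFunctor k S G ⋙ tensorFunctor k S G ⟶
    𝟭 (ModuleCat.{u} (SkewMonoidAlgebra S G)) where
  app M := homOfCommutes
    (invMul k M ∘ₗ (tensorObjEquiv k ((invFunctor k S G).obj M)).symm.toLinearMap)
    (fun g x => (congrArg (invMul k M ∘ (tensorObjEquiv k ((invFunctor k S G).obj M)).symm)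
      (act_tensorObjEquiv k ((invFunctor k S G).obj M) g x)).trans
        (invMul_rTensor_actS k M g x))
  naturality M N f := by
    ext x
    exact invMul_lTensor k f x

theorem dualMap_homBase_invMulNat_bijective (M : ModuleCat.{u} (SkewMonoidAlgebra S G))
    (h : Function.Bijective (invMul k M).dualMap) :
    Function.Bijective (homBase ((invMulNat k S G).app M)).dualMap :=
  (tensorObjEquiv k ((invFunctor k S G).obj M)).symm.dualMap.bijective.comp h

/-- The `R`-linear map `N → (S ⊗_R N)^G`, `n ↦ 1 ⊗ n`. -/
def unitTensor (N : ModuleCat.{u} (InvRing k S G)) :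
    N →ₗ[InvRing k S G] invariants k S G ((tensorFunctor k S G).obj N) where
  toFun n := ⟨tensorObjEquiv k N (1 ⊗ₜ n), fun g => by
    rw [act_tensorObjEquiv, tensorAct_tmul, smul_one]⟩
  map_add' m n := by
    ext
    simp [tmul_add]
  map_smul' r n := by
    ext
    change tensorObjEquiv k N (1 ⊗ₜ (r • n)) = (r : S) • tensorObjEquiv k N (1 ⊗ₜ n)
    rw [← map_smul, ← smul_tmul, smul_tmul']
    rfl

variable (S G) in
/-- The natural map `N → ((S ⊗_R N)^{**})^G`. -/
def unitNat : 𝟭 (ModuleCat.{u} (InvRing k S G)) ⟶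
    reflTensorFunctor k S G ⋙ invFunctor k S G where
  app N := ModuleCat.ofHom (unitTensor k N) ≫
    (invFunctor k S G).map ((evalBidualNat S G).app ((tensorFunctor k S G).obj N))
  naturality _ _ _ := rfl

/-- The restriction map `(M^*)^G → Hom_R(M^G, R)`. -/
def restrictDual (M : ModuleCat.{u} (SkewMonoidAlgebra S G)) :
    invariants k S G (dualObj M) →ₗ[InvRing k S G]
      Module.Dual (InvRing k S G) (invariants k S G M) where
  toFun φ :=
    { toFun := fun m => ⟨(dualObjEquiv M).symm (φ : dualObj M) (m : M), fun g => by
        have h := dualObjEquiv_symm_act M g (φ : dualObj M) (m : M)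
        rw [φ.2 g, m.2 g⁻¹] at h
        exact h.symm⟩
      map_add' := fun m n => by
        ext
        simp
      map_smul' := fun r m => by
        ext
        exact ((dualObjEquiv M).symm (φ : dualObj M)).map_smul (r : S) (m : M) }
  map_add' φ ψ := by
    ext m
    simp
  map_smul' r φ := by
    ext m
    exact LinearMap.congr_fun ((dualObjEquiv M).symm.map_smul (r : S) (φ : dualObj M)) (m : M)

theorem coe_restrictDual (M : ModuleCat.{u} (SkewMonoidAlgebra S G))
    (φ : invariants k S G (dualObj M)) (m : invariants k S G M) :
    (restrictDual k M φ m : S) = (dualObjEquiv M).symm (φ : dualObj M) (m : M) := rfl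

/-- The functional s ⊗ m ↦ s f(m) extends uniquely along `invMul` to M; uniqueness makes the
extension G-invariant. -/
theorem restrictDual_bijective (M : ModuleCat.{u} (SkewMonoidAlgebra S G))
    (h : Function.Bijective (invMul k M).dualMap) : Function.Bijective (restrictDual k M) := by
  constructor
  · rw [injective_iff_map_eq_zero]
    intro φ hφ
    have h0 : (invMul k M).dualMap ((dualObjEquiv M).symm (φ : dualObj M)) = 0 := by
      refine TensorProduct.AlgebraTensorModule.ext fun s m => ?_
      rw [LinearMap.dualMap_apply, invMul_tmul, map_smul, ← coe_restrictDual, hφ]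
      simp
    have h1 := (injective_iff_map_eq_zero _).1 h.1 _ h0
    exact Subtype.ext ((LinearEquiv.map_eq_zero_iff _).1 h1)
  · intro f
    obtain ⟨F, hF⟩ := h.2 (LinearMap.liftBaseChange S
      ((Algebra.linearMap (InvRing k S G) S) ∘ₗ f))
    have hF' : ∀ (s : S) (m : invariants k S G M), F (s • (m : M)) = s * f m := fun s m =>
      LinearMap.congr_fun hF (s ⊗ₜ m)
    have hinv : ∀ g, dualAct M g F = F := fun g => by
      apply h.1
      refine TensorProduct.AlgebraTensorModule.ext fun s m => ?_
      rw [LinearMap.dualMap_apply, LinearMap.dualMap_apply, invMul_tmul, dualAct_apply,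
        act_invariants_smul, hF', hF', smul_mul', smul_inv_smul, (f m).2 g]
    refine ⟨⟨dualObjEquiv M F, fun g => by rw [act_dualObjEquiv, hinv]⟩, ?_⟩
    ext m
    rw [coe_restrictDual, LinearEquiv.symm_apply_apply]
    simpa using hF' 1 m

/-- If `S ⊗_R M^G → M` and `S ⊗_R (M^*)^G → M^*` become isomorphisms on duals, then the
invariants of a reflexive module `M` are reflexive. -/
theorem isReflexive_invariants (M : ModuleCat.{u} (SkewMonoidAlgebra S G))
    [Module.IsReflexive S M] (h : Function.Bijective (restrictDual k M))
    (h' : Function.Bijective (restrictDual k (dualObj M))) :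
    Module.IsReflexive (InvRing k S G) (invariants k S G M) := by
  have hev : Function.Bijective (invariantsMap k ((evalBidualNat S G).app M)) :=
    have := isIso_evalBidualNat_app M
    (ConcreteCategory.isIso_iff_bijective _).1
      (inferInstanceAs (IsIso ((invFunctor k S G).map ((evalBidualNat S G).app M))))
  -- Evaluation on M^G is compared with the invariants of M → M^{**}; all other maps in this square
  -- are bijective.
  have hcomp : (LinearEquiv.ofBijective _ h).dualMap ∘
      Module.Dual.eval (InvRing k S G) (invariants k S G M) =
      restrictDual k (dualObj M) ∘ invariantsMap k ((evalBidualNat S G).app M) := rfl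
  refine ⟨(Function.Bijective.of_comp_iff' (LinearEquiv.ofBijective _ h).dualMap.bijective _).1 ?_⟩
  rw [hcomp]
  exact h'.comp hev

/-- The map `((S ⊗_R N)^*)^G → Hom_R(N, R)` is bijective. -/
theorem dualMap_unitTensor_comp_restrictDual_bijective (N : ModuleCat.{u} (InvRing k S G)) :
    Function.Bijective ((unitTensor k N).dualMap ∘ₗ
      restrictDual k ((tensorFunctor k S G).obj N)) := by
  constructor
  · rw [injective_iff_map_eq_zero]
    intro φ hφ
    have h0 : ((dualObjEquiv _).symm (φ : dualObj ((tensorFunctor k S G).obj N))) ∘ₗ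
        (tensorObjEquiv k N).toLinearMap = 0 := by
      refine TensorProduct.AlgebraTensorModule.ext fun s n => ?_
      have hn : (dualObjEquiv _).symm (φ : dualObj ((tensorFunctor k S G).obj N))
          (tensorObjEquiv k N (1 ⊗ₜ n)) = 0 :=
        congrArg Subtype.val (LinearMap.congr_fun hφ n)
      have hs : s ⊗ₜ[InvRing k S G] n = s • (1 ⊗ₜ[InvRing k S G] n) := by
        rw [smul_tmul', smul_eq_mul, mul_one]
      rw [hs, map_smul, LinearMap.comp_apply, LinearEquiv.coe_coe, hn, smul_zero]
      rfl
    refine Subtype.ext ((LinearEquiv.map_eq_zero_iff (dualObjEquiv _).symm).1 ?_)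
    refine LinearMap.ext fun x => ?_
    obtain ⟨x, rfl⟩ := (tensorObjEquiv k N).surjective x
    exact LinearMap.congr_fun h0 x
  · intro f
    let F : Module.Dual S ((tensorFunctor k S G).obj N) :=
      LinearMap.liftBaseChange S ((Algebra.linearMap (InvRing k S G) S) ∘ₗ f) ∘ₗ
        (tensorObjEquiv k N).symm.toLinearMap
    have hF : ∀ (s : S) (n : N), F (tensorObjEquiv k N (s ⊗ₜ n)) = s * f n := fun s n => rfl
    have hinv : ∀ g, dualAct _ g F = F := fun g => by
      refine LinearMap.ext fun x => ?_
      obtain ⟨x, rfl⟩ := (tensorObjEquiv k N).surjective x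
      rw [dualAct_apply, act_tensorObjEquiv]
      induction x with
      | zero => simp
      | tmul s n => rw [tensorAct_tmul, hF, hF, smul_mul', smul_inv_smul, (f n).2 g]
      | add x y hx hy => rw [map_add, map_add, map_add, smul_add, hx, hy, map_add, map_add]
    refine ⟨⟨dualObjEquiv _ F, fun g => by rw [act_dualObjEquiv, hinv]⟩, ?_⟩
    ext n
    exact (hF 1 n).trans (one_mul _)

/-- Followed by restriction of functionals, the unit becomes N → N^{**}, once N^* is identified with
((S ⊗_R N)^*)^G. -/
theorem isIso_unitNat_app (N : ModuleCat.{u} (InvRing k S G))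
    [Module.IsReflexive (InvRing k S G) N]
    (h : Function.Bijective (restrictDual k (dualObj ((tensorFunctor k S G).obj N)))) :
    IsIso ((unitNat k S G).app N) := by
  rw [ConcreteCategory.isIso_iff_bijective]
  let α := LinearEquiv.ofBijective _ (dualMap_unitTensor_comp_restrictDual_bijective k N)
  have hcomp : α.dualMap ∘ Module.Dual.eval (InvRing k S G) N =
      restrictDual k (dualObj ((tensorFunctor k S G).obj N)) ∘ ((unitNat k S G).app N).hom := rfl
  refine (Function.Bijective.of_comp_iff' h _).1 (hcomp ▸ ?_)
  exact α.dualMap.bijective.comp (Module.bijective_dual_eval (InvRing k S G) N)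

end Adjunction

/-! ### Assembling the equivalence -/

section Equivalence

variable (k : Type v) [CommRing k] {S : Type u} [CommRing S] [Algebra k S]
  {G : Type u} [Group G] [MulSemiringAction G S] [SMulCommClass G k S]

/-- The bidual `(S ⊗_R M^G)^{**} → M^{**}` of the natural map `S ⊗_R M^G → M`. -/
def bidualInvMul (M : ModuleCat.{u} (SkewMonoidAlgebra S G)) :
    (reflTensorFunctor k S G).obj ((invFunctor k S G).obj M) ⟶ (bidualFunctor S G).obj M :=
  (bidualFunctor S G).map ((invMulNat k S G).app M)

theorem bidualInvMul_naturality {M N : ModuleCat.{u} (SkewMonoidAlgebra S G)} (f : M ⟶ N) :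
    (reflTensorFunctor k S G).map ((invFunctor k S G).map f) ≫ bidualInvMul k N =
      bidualInvMul k M ≫ (bidualFunctor S G).map f :=
  (((bidualFunctor S G).map_comp _ _).symm.trans
    (congrArg (bidualFunctor S G).map ((invMulNat k S G).naturality f))).trans
      ((bidualFunctor S G).map_comp _ _)

/-- The functor `M ↦ M^G` from `Ref(S * G)` to `Ref(R)`. -/
abbrev refInvFunctor (hInv : ∀ M, IsRefSkew S G M →
    IsRef (InvRing k S G) ((invFunctor k S G).obj M)) :
    (IsRefSkew S G).FullSubcategory ⥤ (IsRef (InvRing k S G)).FullSubcategory :=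
  (IsRef (InvRing k S G)).lift ((IsRefSkew S G).ι ⋙ invFunctor k S G)
    (fun M => hInv M.obj M.property)

/-- The functor `N ↦ (S ⊗_R N)^{**}` from `Ref(R)` to `Ref(S * G)`. -/
abbrev refTensorFunctor (hTensor : ∀ N, IsRef (InvRing k S G) N →
    IsRefSkew S G ((reflTensorFunctor k S G).obj N)) :
    (IsRef (InvRing k S G)).FullSubcategory ⥤ (IsRefSkew S G).FullSubcategory :=
  (IsRefSkew S G).lift ((IsRef (InvRing k S G)).ι ⋙ reflTensorFunctor k S G)
    (fun N => hTensor N.obj N.property)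

variable [IsDomain S] [IsNoetherianRing S]

theorem isRefSkew_reflTensorFunctor_obj (N : ModuleCat.{u} (InvRing k S G))
    (hN : IsRef (InvRing k S G) N) : IsRefSkew S G ((reflTensorFunctor k S G).obj N) := by
  have := hN.1
  have : Module.Finite S ((tensorFunctor k S G).obj N) :=
    Module.Finite.equiv (tensorObjEquiv k N)
  have := finite_dualObj ((tensorFunctor k S G).obj N)
  have := finite_dualObj (dualObj ((tensorFunctor k S G).obj N))
  exact ⟨finite_skew (dualObj (dualObj ((tensorFunctor k S G).obj N))),
    isReflexive_dualObj (dualObj ((tensorFunctor k S G).obj N))⟩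

variable [IsIntegrallyClosed S] [Finite G] [FaithfulSMul G S]

theorem isRef_invFunctor_obj (hG : IsUnit (Nat.card G : S))
    (hunr : UnramifiedInCodimOne (InvRing k S G) S)
    (M : ModuleCat.{u} (SkewMonoidAlgebra S G)) (hM : IsRefSkew S G M) :
    IsRef (InvRing k S G) ((invFunctor k S G).obj M) :=
  have := hM.1
  have := hM.2
  have hr := fun N => restrictDual_bijective k N (dualMap_invMul_bijective k hG hunr N)
  ⟨finite_invariants k hG hunr M, isReflexive_invariants k M (hr _) (hr _)⟩

theorem isIso_bidualInvMul (hG : IsUnit (Nat.card G : S))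
    (hunr : UnramifiedInCodimOne (InvRing k S G) S)
    (M : ModuleCat.{u} (SkewMonoidAlgebra S G)) : IsIso (bidualInvMul k M) :=
  have := isIso_dualFunctor_map ((invMulNat k S G).app M)
    (dualMap_homBase_invMulNat_bijective k M (dualMap_invMul_bijective k hG hunr M))
  inferInstanceAs (IsIso ((dualFunctor S G).map
    ((dualFunctor S G).map ((invMulNat k S G).app M).op).op))

/-- The isomorphism `M ≅ (S ⊗_R M^G)^{**}`. -/
def reflTensorInvIso (hG : IsUnit (Nat.card G : S))
    (hunr : UnramifiedInCodimOne (InvRing k S G) S)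
    (M : ModuleCat.{u} (SkewMonoidAlgebra S G)) [Module.IsReflexive S M] :
    M ≅ (reflTensorFunctor k S G).obj ((invFunctor k S G).obj M) :=
  have := isIso_evalBidualNat_app M
  have := isIso_bidualInvMul k hG hunr M
  asIso ((evalBidualNat S G).app M) ≪≫ (asIso (bidualInvMul k M)).symm

/-- Describes the isomorphism without inverses, so that naturality follows by cancelling
`bidualInvMul`. -/
theorem reflTensorInvIso_hom_comp (hG : IsUnit (Nat.card G : S))
    (hunr : UnramifiedInCodimOne (InvRing k S G) S)
    (M : ModuleCat.{u} (SkewMonoidAlgebra S G)) [Module.IsReflexive S M] :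
    (reflTensorInvIso k hG hunr M).hom ≫ bidualInvMul k M = (evalBidualNat S G).app M := by
  have := isIso_bidualInvMul k hG hunr M
  exact (Category.assoc _ (asIso (bidualInvMul k M)).inv (asIso (bidualInvMul k M)).hom).trans
    ((congrArg _ (asIso (bidualInvMul k M)).inv_hom_id).trans (Category.comp_id _))

theorem reflTensorInvIso_naturality (hG : IsUnit (Nat.card G : S))
    (hunr : UnramifiedInCodimOne (InvRing k S G) S)
    {M N : ModuleCat.{u} (SkewMonoidAlgebra S G)} [Module.IsReflexive S M]
    [Module.IsReflexive S N] (f : M ⟶ N) :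
    f ≫ (reflTensorInvIso k hG hunr N).hom = (reflTensorInvIso k hG hunr M).hom ≫
      (reflTensorFunctor k S G).map ((invFunctor k S G).map f) := by
  have := isIso_bidualInvMul k hG hunr N
  rw [← cancel_mono (bidualInvMul k N), Category.assoc, reflTensorInvIso_hom_comp, Category.assoc,
    bidualInvMul_naturality, ← Category.assoc, reflTensorInvIso_hom_comp]
  exact (evalBidualNat S G).naturality f

/-- The natural isomorphism `M ≅ (S ⊗_R M^G)^{**}` on `Ref(S * G)`. -/
def refUnitIso (hG : IsUnit (Nat.card G : S)) (hunr : UnramifiedInCodimOne (InvRing k S G) S) :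
    𝟭 (IsRefSkew S G).FullSubcategory ≅
      refInvFunctor k (isRef_invFunctor_obj k hG hunr) ⋙
        refTensorFunctor k (isRefSkew_reflTensorFunctor_obj k) :=
  NatIso.ofComponents
    (fun M =>
      have := M.property.2
      ObjectProperty.isoMk _ (reflTensorInvIso k hG hunr M.obj))
    (fun {M N} f => by
      have := M.property.2
      have := N.property.2
      apply ObjectProperty.hom_ext
      exact reflTensorInvIso_naturality k hG hunr f.hom)

/-- The natural isomorphism `((S ⊗_R N)^{**})^G ≅ N` on `Ref(R)`. -/
def refCounitIso (hG : IsUnit (Nat.card G : S)) (hunr : UnramifiedInCodimOne (InvRing k S G) S) :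
    refTensorFunctor k (isRefSkew_reflTensorFunctor_obj k) ⋙
      refInvFunctor k (isRef_invFunctor_obj k hG hunr) ≅
        𝟭 (IsRef (InvRing k S G)).FullSubcategory :=
  Iso.symm <| NatIso.ofComponents
    (fun N =>
      have := N.property.2
      have := isIso_unitNat_app k N.obj
        (restrictDual_bijective k _ (dualMap_invMul_bijective k hG hunr _))
      ObjectProperty.isoMk _ (asIso ((unitNat k S G).app N.obj)))
    (fun {M N} f => by
      apply ObjectProperty.hom_ext
      exact (unitNat k S G).naturality f.hom)

/-- The equivalence between `Ref(S * G)` and `Ref(S^G)`. -/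
def refEquivalence (hG : IsUnit (Nat.card G : S))
    (hunr : UnramifiedInCodimOne (InvRing k S G) S) :
    (IsRefSkew S G).FullSubcategory ≌ (IsRef (InvRing k S G)).FullSubcategory :=
  -- Only the unit is adjusted to meet the triangle identity; both functors are kept, so they can
  -- later be identified by `rfl`.
  CategoryTheory.Equivalence.mk _ _ (refUnitIso k hG hunr) (refCounitIso k hG hunr)

end Equivalence

end AuslanderRef

end

theorem theorem3p4p13 {k : Type v} [Field k] [IsAlgClosed k]
    {S : Type u} [CommRing S] [IsDomain S] [IsLocalRing S] [IsNoetherianRing S]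
    [IsIntegrallyClosed S] [Algebra k S]
    (hres : Function.Bijective (algebraMap k (IsLocalRing.ResidueField S)))
    (G : Subgroup (S ≃ₐ[k] S)) [Finite G] (hG : IsUnit (Nat.card G : k))
    (hunr : AuslanderRef.UnramifiedInCodimOne (AuslanderRef.InvRing k S G) S) :
    ∃ (hInv : ∀ M, AuslanderRef.IsRefSkew S G M →
        AuslanderRef.IsRef (AuslanderRef.InvRing k S G) ((AuslanderRef.invFunctor k S G).obj M))
      (hTensor : ∀ N, AuslanderRef.IsRef (AuslanderRef.InvRing k S G) N →
        AuslanderRef.IsRefSkew S G ((AuslanderRef.reflTensorFunctor k S G).obj N))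
      (e : (AuslanderRef.IsRefSkew S G).FullSubcategory ≌
        (AuslanderRef.IsRef (AuslanderRef.InvRing k S G)).FullSubcategory),
      e.functor = (AuslanderRef.IsRef (AuslanderRef.InvRing k S G)).lift
        ((AuslanderRef.IsRefSkew S G).ι ⋙ AuslanderRef.invFunctor k S G)
        (fun M => hInv M.obj M.property) ∧
      e.inverse = (AuslanderRef.IsRefSkew S G).lift
        ((AuslanderRef.IsRef (AuslanderRef.InvRing k S G)).ι ⋙
          AuslanderRef.reflTensorFunctor k S G)
        (fun N => hTensor N.obj N.property) := by
  have hGS : IsUnit (Nat.card G : S) := by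
    have := hG.map (algebraMap k S)
    rwa [map_natCast] at this
  exact ⟨AuslanderRef.isRef_invFunctor_obj k hGS hunr,
    AuslanderRef.isRefSkew_reflTensorFunctor_obj k, AuslanderRef.refEquivalence k hGS hunr,
    rfl, rfl⟩
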